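/- Let $W:[0,1]^2\to[0,1]$ be a graphon, i.e. a symmetric measurable function. Suppose that $$W(x,y)=\sum_{i=1}^\infty \omega_i\,\varphi_i(x)\varphi_i(y)\quad\text{with convergence in } L^2([0,1]^2),$$ where $(\varphi_i)_{i\ge1}$ is orthonormal in $L^2[0,1]$ and the real numbers $\omega_i$ (zero values being allowed) satisfy $\sum_{i}|\omega_i|<\infty$ and $|\omega_i|\le i^{-\alpha}$ for all $i\ge 1$, for some $\alpha>1/2$. Suppose moreover that the diagonal tails vanish in $L^2$: $$\Big\|\sum_{i=k+1}^\infty \omega_i\varphi_i^2\Big\|_{L^2[0,1]}\longrightarrow 0\qquad (k\to\infty).$$ Then there is a constant $C$ such that for all integers $n\ge1$ and $k\ge1$ the following holds. Let $\xi_1,\dots,\xi_n$ be independent and uniformly distributed on $[0,1]$, let $M$ be the symmetric $n\times n$ matrix with entries $M_{uv}=W(\xi_u,\xi_v)$ for $u\ne v$ and $M_{uu}=0$, and let $\lambda_1(M),\dots,\lambda_n(M)$ be its eigenvalues with multiplicity, ordered so that $|\lambda_1(M)|\ge\dots\ge|\lambda_n(M)|$. Then each $\lambda_i(M)^2$ is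 integrable and $$\frac1{n^2}\sum_{i=k+1}^n \mathbb E\big[\lambda_i(M)^2\big]\le \frac{2k^{1-2\alpha}}{2\alpha-1}+\frac Cn .$$ In particular $C$ depends neither on $k$ nor on $n$. -/

import Mathlib

open MeasureTheory ProbabilityTheory Filter Topology

universe u

/-- A graphon: a symmetric measurable function `[0,1]² → [0,1]`. -/
structure Graphon where
  toFun : unitInterval → unitInterval → ℝ
  measurable' : Measurable (Function.uncurry toFun)
  symm' : ∀ x y, toFun x y = toFun y x
  nonneg' : ∀ x y, 0 ≤ toFun x y
  le_one' : ∀ x y, toFun x y ≤ 1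

namespace Graphon

instance : CoeFun Graphon (fun _ => unitInterval → unitInterval → ℝ) := ⟨Graphon.toFun⟩

/-- `W = ∑ ωᵢ φᵢ ⊗ φᵢ` with `(φᵢ)` orthonormal in `L²[0,1]`, the series converging in
`L²([0,1]²)`, and `∑ |ωᵢ| < ∞` (trace class). Indices start at `0`, so that `ω i` and `φ i` are
the `(i + 1)`-st eigenvalue and eigenfunction. Zero eigenvalues are allowed, so graphons of finite
rank are included. -/
structure IsTraceClassSpectralDecomposition (W : Graphon) (ω : ℕ → ℝ)
    (φ : ℕ → unitInterval → ℝ) : Prop where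
  memLp : ∀ i, MemLp (φ i) 2 volume
  orthonormal : ∀ i j, ∫ x, φ i x * φ j x = if i = j then 1 else 0
  tendsto_L2 : Tendsto
    (fun m : ℕ => eLpNorm (fun p : unitInterval × unitInterval =>
      W p.1 p.2 - ∑ i ∈ Finset.range m, ω i * φ i p.1 * φ i p.2) 2 volume) atTop (𝓝 0)
  summable_abs : Summable (fun i => |ω i|)

/-- The sampled matrix: `M u v = W (ξ u) (ξ v)` off the diagonal, and zero on the diagonal. -/
def sampleMatrix (W : Graphon) {n : ℕ} (ξ : Fin n → unitInterval) : Matrix (Fin n) (Fin n) ℝ :=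
  Matrix.of fun u v => if u = v then 0 else W (ξ u) (ξ v)

theorem sampleMatrix_isHermitian (W : Graphon) {n : ℕ} (ξ : Fin n → unitInterval) :
    (W.sampleMatrix ξ).IsHermitian := by
  ext u v
  simp [sampleMatrix, Matrix.conjTranspose_apply, eq_comm, W.symm' (ξ u) (ξ v)]

end Graphon

/-- The diagonal tails `x ↦ ∑_{i ≥ k} ωᵢ φᵢ(x)²` (indices from `0`, so the first `k` terms are left
out) tend to `0` in `L²[0,1]`. For orthonormal `φ` and `∑ |ωᵢ| < ∞` these series converge absolutely
at almost every `x`. -/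
def L2DiagonalTail (ω : ℕ → ℝ) (φ : ℕ → unitInterval → ℝ) : Prop :=
  Tendsto (fun k : ℕ => eLpNorm (fun x : unitInterval =>
    ∑' i : ℕ, ω (i + k) * φ (i + k) x ^ 2) 2 volume) atTop (𝓝 0)

/-- The eigenvalues, with multiplicity, of a real symmetric matrix in order of decreasing absolute
value: `eigenvaluesByAbs hA i` is the `(i + 1)`-st one. -/
noncomputable def eigenvaluesByAbs {n : ℕ} {A : Matrix (Fin n) (Fin n) ℝ} (hA : A.IsHermitian)
    (i : Fin n) : ℝ :=
  hA.eigenvalues (Tuple.sort (fun j => -|hA.eigenvalues j|) i)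

/-!
By the Eckart–Young theorem, the sum of all but the `k` largest squared eigenvalues of a symmetric
matrix `M` is the squared Frobenius distance from `M` to the matrices of rank at most `k`
(`rankDistSq_eq`). For the sampled matrix, the partial sum `W_k = ∑_{i < k} ω_i φ_i ⊗ φ_i`, evaluated
at the sample points and with its diagonal kept, is an approximant of rank at most `k`, so that the
sum in question is at most `∑_{u, v} (M_{uv} - W_k(ξ_u, ξ_v))²`.

In expectation, each of the at most `n²` off-diagonal entries contributes `‖W - W_k‖²`, which equals
`∑_{i ≥ k} ω_i²` and is at most `k ^ (1 - 2α) / (2α - 1)` by the integral test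
(`integral_kernel_sub_sq_le`). As `M` vanishes on the diagonal, each of the `n` diagonal entries
contributes the squared `L²` norm of `x ↦ W_k(x, x)`, which is bounded uniformly in `k`
(`exists_integral_diagonal_sum_sq_le`): the eigenvalue equation gives `|ω_i φ_i| ≤ 1` almost
everywhere, so each partial sum of the diagonal is in `L²`, and by hypothesis the tails are
eventually small. Dividing by `n²` gives the bound, even without the factor two.

The Eckart–Young theorem also yields integrability. The squared distance to the matrices of rank at
most `k` is an infimum of continuous functions, hence measurable (`measurable_rankDistSq`), and each
squared eigenvalue is a difference of two such distances (`eigenvaluesByAbs_sq_eq`).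
-/

/-! ### Best approximation by matrices of bounded rank -/

/-- The squared Frobenius distance from `A` to the matrix `∑_{l < k} a_l b_lᵀ`; as `a` and `b` vary,
the latter runs over all matrices of rank at most `k`. -/
noncomputable def rankApproxError {n : ℕ} (k : ℕ) (A : Matrix (Fin n) (Fin n) ℝ)
    (a b : ℕ → Fin n → ℝ) : ℝ :=
  ∑ u, ∑ v, (A u v - ∑ l ∈ Finset.range k, a l u * b l v) ^ 2

/-- The squared Frobenius distance from `A` to the set of matrices of rank at most `k`. -/
noncomputable def rankDistSq {n : ℕ} (k : ℕ) (A : Matrix (Fin n) (Fin n) ℝ) : ℝ :=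
  ⨅ p : (ℕ → Fin n → ℝ) × (ℕ → Fin n → ℝ), rankApproxError k A p.1 p.2

theorem rankApproxError_nonneg {n : ℕ} (k : ℕ) (A : Matrix (Fin n) (Fin n) ℝ)
    (a b : ℕ → Fin n → ℝ) : 0 ≤ rankApproxError k A a b := by
  unfold rankApproxError; positivity

/-- An infimum of continuous functions is upper semicontinuous, hence measurable, even though the
index set is uncountable. -/
theorem measurable_rankDistSq {n : ℕ} (k : ℕ) :
    Measurable (fun A : Fin n → Fin n → ℝ => rankDistSq k (Matrix.of A)) := by
  apply UpperSemicontinuous.measurable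
  apply upperSemicontinuous_ciInf
  · intro A
    exact ⟨0, by rintro _ ⟨p, rfl⟩; exact rankApproxError_nonneg _ _ _ _⟩
  · intro p
    apply Continuous.upperSemicontinuous
    simp only [rankApproxError, Matrix.of_apply]
    fun_prop

/-- A Parseval identity for expansions in an orthonormal family. -/
theorem sum_sq_sum_mul_orthonormal {n : ℕ} {e : Fin n → EuclideanSpace ℝ (Fin n)}
    (he : Orthonormal ℝ e) (c : Fin n → ℝ) :
    ∑ v, (∑ i, c i * e i v) ^ 2 = ∑ i, c i ^ 2 := by
  have h := he.inner_sum c c Finset.univ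
  rw [real_inner_self_eq_norm_sq, EuclideanSpace.norm_sq_eq] at h
  simpa [sq_abs, ← sq] using h

theorem EuclideanSpace.real_inner_eq_sum {n : ℕ} (x y : EuclideanSpace ℝ (Fin n)) :
    inner ℝ x y = ∑ v, x v * y v := by
  simp [PiLp.inner_apply, mul_comm]

/-- If the weights `p i ∈ [0, 1]` have total mass at least `n - k`, then the `p`-weighted sum of a
nonnegative antitone sequence of length `n` is at least the sum of its last `n - k` terms. -/
theorem sum_tail_le_sum_mul {n k : ℕ} {s p : Fin n → ℝ} (hs : Antitone s) (hs0 : ∀ i, 0 ≤ s i)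
    (hp0 : ∀ i, 0 ≤ p i) (hp1 : ∀ i, p i ≤ 1) (hp : (n : ℝ) - k ≤ ∑ i, p i) :
    ∑ i ∈ Finset.univ.filter (fun j : Fin n => k ≤ (j : ℕ)), s i ≤ ∑ i, s i * p i := by
  rcases le_or_gt n k with hkn | hkn
  · rw [Finset.filter_false_of_mem (fun i _ => by omega), Finset.sum_empty]
    exact Finset.sum_nonneg fun i _ => mul_nonneg (hs0 i) (hp0 i)
  have hterm : ∀ i : Fin n, s ⟨k, hkn⟩ * (p i - if k ≤ (i : ℕ) then 1 else 0) ≤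
      s i * (p i - if k ≤ (i : ℕ) then 1 else 0) := by
    intro i
    split_ifs with h
    · exact mul_le_mul_of_nonpos_right (hs (show (⟨k, hkn⟩ : Fin n) ≤ i from h))
        (by linarith [hp1 i])
    · exact mul_le_mul_of_nonneg_right (hs (show i ≤ (⟨k, hkn⟩ : Fin n) from by
        rw [Fin.le_def]; simp; omega)) (by linarith [hp0 i])
  have hsum := Finset.sum_le_sum fun i (_ : i ∈ Finset.univ) => hterm i
  have hcard : ∑ i : Fin n, (if k ≤ (i : ℕ) then (1 : ℝ) else 0) = n - k := by
    rw [Fin.sum_univ_eq_sum_range (fun i => if k ≤ i then (1 : ℝ) else 0) n, ← Finset.sum_filter,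
      show (Finset.range n).filter (fun i => k ≤ i) = Finset.Ico k n by ext; simp; omega]
    simp [Nat.cast_sub hkn.le]
  rw [← Finset.mul_sum, Finset.sum_sub_distrib, hcard] at hsum
  simp only [mul_sub, Finset.sum_sub_distrib, mul_ite, mul_one, mul_zero] at hsum
  rw [Finset.sum_filter]
  nlinarith [mul_nonneg (hs0 ⟨k, hkn⟩) (sub_nonneg.2 hp)]

/-- The lower bound of the Eckart–Young theorem for a symmetric matrix `A = ∑ ν_i e_i e_iᵀ`. An
approximant `B` of rank at most `k` vanishes on a subspace of dimension at least `n - k`, and on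
that subspace `A - B` acts as `A`. -/
theorem sum_tail_sq_le_rankApproxError {n : ℕ} (k : ℕ) {A : Matrix (Fin n) (Fin n) ℝ}
    (e : OrthonormalBasis (Fin n) ℝ (EuclideanSpace ℝ (Fin n))) {ν : Fin n → ℝ}
    (hA : ∀ u v, A u v = ∑ i, ν i * e i u * e i v) (hν : Antitone fun i => ν i ^ 2)
    (a b : ℕ → Fin n → ℝ) :
    ∑ i ∈ Finset.univ.filter (fun j : Fin n => k ≤ (j : ℕ)), ν i ^ 2 ≤
      rankApproxError k A a b := by
  classical
  let K : Submodule ℝ (EuclideanSpace ℝ (Fin n)) :=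
    Submodule.span ℝ ((Finset.range k).image fun l => WithLp.toLp 2 (b l) :
      Finset (EuclideanSpace ℝ (Fin n)))
  let f := stdOrthonormalBasis ℝ Kᗮ
  have hK : Module.finrank ℝ K ≤ k := by
    refine (finrank_span_finset_le_card _).trans (Finset.card_image_le.trans ?_)
    simp
  have hdim := K.finrank_add_finrank_orthogonal
  rw [finrank_euclideanSpace, Fintype.card_fin] at hdim
  have hf : Orthonormal ℝ fun j => (f j : EuclideanSpace ℝ (Fin n)) :=
    f.orthonormal.comp_linearIsometry Kᗮ.subtypeₗᵢ
  have hfb : ∀ j, ∀ l ∈ Finset.range k, ∑ v, b l v * (f j : EuclideanSpace ℝ (Fin n)) v = 0 := by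
    intro j l hl
    have hmem : WithLp.toLp 2 (b l) ∈ K :=
      Submodule.subset_span (by simpa using ⟨l, Finset.mem_range.1 hl, rfl⟩)
    have := (Submodule.mem_orthogonal K _).1 (f j).2 _ hmem
    simpa [EuclideanSpace.real_inner_eq_sum] using this
  -- `p i` is the squared length of the projection of `e i` to the subspace.
  let p : Fin n → ℝ := fun i => ∑ j, inner ℝ (e i) (f j : EuclideanSpace ℝ (Fin n)) ^ 2
  have hp1 : ∀ i, p i ≤ 1 := by
    intro i
    have := hf.sum_inner_products_le (e i) (s := Finset.univ)
    rw [e.orthonormal.1 i] at this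
    simpa [p, real_inner_comm] using this
  have hpsum : ∑ i, p i = Module.finrank ℝ Kᗮ := by
    simp only [p]
    rw [Finset.sum_comm]
    have : ∀ j, ∑ i, inner ℝ (e i) (f j : EuclideanSpace ℝ (Fin n)) ^ 2 = 1 := by
      intro j
      have := e.sum_sq_norm_inner_right (f j : EuclideanSpace ℝ (Fin n))
      rw [hf.1 j] at this
      simpa using this
    simp [this]
  refine (sum_tail_le_sum_mul (p := p) hν (fun i => sq_nonneg _)
    (fun i => Finset.sum_nonneg fun j _ => sq_nonneg _) hp1 ?_).trans ?_
  · rw [hpsum]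
    have : n ≤ k + Module.finrank ℝ Kᗮ := by omega
    have : (n : ℝ) ≤ k + Module.finrank ℝ Kᗮ := by exact_mod_cast this
    linarith
  let R : Fin n → EuclideanSpace ℝ (Fin n) :=
    fun u => WithLp.toLp 2 fun v => A u v - ∑ l ∈ Finset.range k, a l u * b l v
  have hR : ∀ u j, inner ℝ (R u) (f j : EuclideanSpace ℝ (Fin n)) =
      ∑ i, (ν i * inner ℝ (e i) (f j : EuclideanSpace ℝ (Fin n))) * e i u := by
    intro u j
    have h1 : ∑ v, (∑ l ∈ Finset.range k, a l u * b l v) *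
        (f j : EuclideanSpace ℝ (Fin n)) v = 0 := by
      simp_rw [Finset.sum_mul]
      rw [Finset.sum_comm]
      refine Finset.sum_eq_zero fun l hl => ?_
      simp_rw [mul_assoc]
      rw [← Finset.mul_sum, hfb j l hl, mul_zero]
    simp only [R, EuclideanSpace.real_inner_eq_sum, sub_mul, Finset.sum_sub_distrib, h1, sub_zero,
      hA]
    simp_rw [Finset.sum_mul]
    rw [Finset.sum_comm]
    refine Finset.sum_congr rfl fun i _ => ?_
    rw [Finset.mul_sum, Finset.sum_mul]
    exact Finset.sum_congr rfl fun v _ => by ring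
  calc ∑ i, ν i ^ 2 * p i
      = ∑ j, ∑ u, inner ℝ (R u) (f j : EuclideanSpace ℝ (Fin n)) ^ 2 := by
        simp_rw [hR, sum_sq_sum_mul_orthonormal e.orthonormal, mul_pow]
        rw [Finset.sum_comm]
        simp [p, Finset.mul_sum]
    _ = ∑ u, ∑ j, inner ℝ (R u) (f j : EuclideanSpace ℝ (Fin n)) ^ 2 := Finset.sum_comm
    _ ≤ ∑ u, ‖R u‖ ^ 2 := by
        refine Finset.sum_le_sum fun u _ => ?_
        simpa [real_inner_comm] using hf.sum_inner_products_le (R u) (s := Finset.univ)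
    _ = rankApproxError k A a b := by
        simp [R, EuclideanSpace.norm_sq_eq, rankApproxError]

/-- Truncating the spectral expansion attains the lower bound. -/
theorem exists_rankApproxError_eq {n : ℕ} (k : ℕ) {A : Matrix (Fin n) (Fin n) ℝ}
    (e : OrthonormalBasis (Fin n) ℝ (EuclideanSpace ℝ (Fin n))) {ν : Fin n → ℝ}
    (hA : ∀ u v, A u v = ∑ i, ν i * e i u * e i v) :
    ∃ a b : ℕ → Fin n → ℝ, rankApproxError k A a b =
      ∑ i ∈ Finset.univ.filter (fun j : Fin n => k ≤ (j : ℕ)), ν i ^ 2 := by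
  refine ⟨fun l u => if h : l < n then ν ⟨l, h⟩ * e ⟨l, h⟩ u else 0,
    fun l u => if h : l < n then e ⟨l, h⟩ u else 0, ?_⟩
  have hB : ∀ u v : Fin n, A u v - ∑ l ∈ Finset.range k,
      (if h : l < n then ν ⟨l, h⟩ * e ⟨l, h⟩ u else 0) * (if h : l < n then e ⟨l, h⟩ v else 0) =
      ∑ i : Fin n, (if k ≤ (i : ℕ) then ν i * e i u else 0) * e i v := by
    intro u v
    have h1 : ∑ l ∈ Finset.range k, (if h : l < n then ν ⟨l, h⟩ * e ⟨l, h⟩ u else 0) *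
        (if h : l < n then e ⟨l, h⟩ v else 0) =
        ∑ i : Fin n, (if (i : ℕ) < k then ν i * e i u * e i v else 0) := by
      let g : ℕ → ℝ := fun l => if h : l < n then ν ⟨l, h⟩ * e ⟨l, h⟩ u * e ⟨l, h⟩ v else 0
      have h2 : ∑ i : Fin n, (if (i : ℕ) < k then ν i * e i u * e i v else 0) =
          ∑ l ∈ Finset.range n, if l < k then g l else 0 := by
        rw [← Fin.sum_univ_eq_sum_range (fun l => if l < k then g l else 0) n]
        simp [g]
      rw [h2, ← Finset.sum_filter]
      have h3 : ∀ l, (if h : l < n then ν ⟨l, h⟩ * e ⟨l, h⟩ u else 0) *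
          (if h : l < n then e ⟨l, h⟩ v else 0) = g l := by
        intro l; simp only [g]; split_ifs <;> simp
      simp_rw [h3]
      symm
      refine Finset.sum_subset (fun l hl => by simp at hl ⊢; omega) fun l hl hl' => ?_
      have : ¬ l < n := fun h => hl' (by simp at hl ⊢; omega)
      simp [g, this]
    rw [h1, hA, ← Finset.sum_sub_distrib]
    refine Finset.sum_congr rfl fun i _ => ?_
    by_cases h : k ≤ (i : ℕ)
    · simp [h, not_lt.2 h]
    · simp [h, not_le.1 h]
  unfold rankApproxError
  simp_rw [hB, sum_sq_sum_mul_orthonormal e.orthonormal]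
  rw [Finset.sum_comm, Finset.sum_filter]
  refine Finset.sum_congr rfl fun i _ => ?_
  split_ifs
  · have := e.orthonormal.1 i
    simp_rw [mul_pow]
    rw [← Finset.mul_sum]
    have h := EuclideanSpace.norm_sq_eq (e i)
    rw [this] at h
    simp at h
    rw [← h, mul_one]
  · simp

theorem eigenvaluesByAbs_sq_antitone {n : ℕ} {A : Matrix (Fin n) (Fin n) ℝ} (hA : A.IsHermitian) :
    Antitone fun i => eigenvaluesByAbs hA i ^ 2 := by
  intro i j hij
  have := Tuple.monotone_sort (fun j => -|hA.eigenvalues j|) hij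
  simp only [Function.comp_apply, neg_le_neg_iff] at this
  exact sq_le_sq.2 this

/-- The spectral theorem in coordinates, for the ordering by absolute value. -/
theorem exists_eigenbasis_eigenvaluesByAbs {n : ℕ} {A : Matrix (Fin n) (Fin n) ℝ}
    (hA : A.IsHermitian) : ∃ e : OrthonormalBasis (Fin n) ℝ (EuclideanSpace ℝ (Fin n)),
      ∀ u v, A u v = ∑ i, eigenvaluesByAbs hA i * e i u * e i v := by
  let σ := Tuple.sort fun j => -|hA.eigenvalues j|
  refine ⟨hA.eigenvectorBasis.reindex σ.symm, fun u v => ?_⟩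
  have h := congrFun (congrFun hA.spectral_theorem u) v
  rw [Unitary.conjStarAlgAut_apply] at h
  simp only [Matrix.mul_apply, Matrix.star_apply,
    Matrix.IsHermitian.eigenvectorUnitary_apply] at h
  rw [h, ← Equiv.sum_comp σ]
  refine Finset.sum_congr rfl fun i _ => ?_
  simp [eigenvaluesByAbs, σ, Matrix.diagonal_apply]
  left
  ring

theorem sum_tail_eigenvaluesByAbs_sq_le {n : ℕ} (k : ℕ) {A : Matrix (Fin n) (Fin n) ℝ}
    (hA : A.IsHermitian) (a b : ℕ → Fin n → ℝ) :
    ∑ i ∈ Finset.univ.filter (fun j : Fin n => k ≤ (j : ℕ)), eigenvaluesByAbs hA i ^ 2 ≤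
      rankApproxError k A a b := by
  obtain ⟨e, he⟩ := exists_eigenbasis_eigenvaluesByAbs hA
  exact sum_tail_sq_le_rankApproxError k e he (eigenvaluesByAbs_sq_antitone hA) a b

/-- The Eckart–Young theorem for symmetric matrices in Frobenius norm. -/
theorem rankDistSq_eq {n : ℕ} (k : ℕ) {A : Matrix (Fin n) (Fin n) ℝ} (hA : A.IsHermitian) :
    rankDistSq k A =
      ∑ i ∈ Finset.univ.filter (fun j : Fin n => k ≤ (j : ℕ)), eigenvaluesByAbs hA i ^ 2 := by
  apply le_antisymm
  · obtain ⟨e, he⟩ := exists_eigenbasis_eigenvaluesByAbs hA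
    obtain ⟨a, b, hab⟩ := exists_rankApproxError_eq k e he
    rw [← hab]
    exact ciInf_le ⟨0, by rintro _ ⟨p, rfl⟩; exact rankApproxError_nonneg _ _ _ _⟩ (a, b)
  · exact le_ciInf fun p => sum_tail_eigenvaluesByAbs_sq_le k hA p.1 p.2

/-- Each squared eigenvalue is a difference of two consecutive squared distances to matrices of
bounded rank; in particular it depends measurably on the matrix. -/
theorem eigenvaluesByAbs_sq_eq {n : ℕ} {A : Matrix (Fin n) (Fin n) ℝ} (hA : A.IsHermitian)
    (i : Fin n) :
    eigenvaluesByAbs hA i ^ 2 = rankDistSq i A - rankDistSq (i + 1) A := by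
  rw [rankDistSq_eq _ hA, rankDistSq_eq _ hA, eq_sub_iff_add_eq']
  rw [show Finset.univ.filter (fun j : Fin n => (i : ℕ) ≤ j) =
    insert i (Finset.univ.filter fun j : Fin n => (i : ℕ) + 1 ≤ j) by
      ext j; simp [Fin.ext_iff]; omega, Finset.sum_insert (by simp), add_comm]

theorem eigenvaluesByAbs_sq_le_sum_sq {n : ℕ} {A : Matrix (Fin n) (Fin n) ℝ} (hA : A.IsHermitian)
    (i : Fin n) : eigenvaluesByAbs hA i ^ 2 ≤ ∑ u, ∑ v, A u v ^ 2 := by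
  -- The only matrix of rank zero is the zero matrix.
  have h := sum_tail_eigenvaluesByAbs_sq_le 0 hA 0 0
  simp only [rankApproxError, Finset.range_zero, Finset.sum_empty, sub_zero, zero_le,
    Finset.filter_true] at h
  exact (Finset.single_le_sum (f := fun i => eigenvaluesByAbs hA i ^ 2)
    (fun j _ => sq_nonneg _) (Finset.mem_univ i)).trans h

/-! ### Square-integrable functions -/

theorem MeasureTheory.MemLp.eLpNorm_two_eq_ofReal_sqrt {X : Type*} [MeasurableSpace X]
    {μ : Measure X} {f : X → ℝ} (hf : MemLp f 2 μ) :
    eLpNorm f 2 μ = ENNReal.ofReal √(∫ x, f x ^ 2 ∂μ) := by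
  rw [hf.eLpNorm_eq_integral_rpow_norm (by simp) (by simp), Real.sqrt_eq_rpow]
  simp

theorem MeasureTheory.MemLp.integral_sq_le_of_eLpNorm_le {X : Type*} [MeasurableSpace X]
    {μ : Measure X} {f : X → ℝ} {c : ℝ} (hf : MemLp f 2 μ) (hc : 0 ≤ c)
    (h : eLpNorm f 2 μ ≤ ENNReal.ofReal c) : ∫ x, f x ^ 2 ∂μ ≤ c ^ 2 := by
  rw [hf.eLpNorm_two_eq_ofReal_sqrt, ENNReal.ofReal_le_ofReal_iff hc] at h
  exact (Real.sqrt_le_left hc).1 h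

/-- The Cauchy–Schwarz inequality against a unit vector. -/
theorem sq_integral_mul_le_of_integral_sq_eq_one {X : Type*} [MeasurableSpace X]
    {μ : Measure X} {f g : X → ℝ} (hf : MemLp f 2 μ) (hg : MemLp g 2 μ)
    (h1 : ∫ x, g x ^ 2 ∂μ = 1) : (∫ x, f x * g x ∂μ) ^ 2 ≤ ∫ x, f x ^ 2 ∂μ := by
  set c := ∫ x, f x * g x ∂μ with hc
  have hfg : Integrable (fun x => f x * g x) μ := hf.integrable_mul hg
  have h0 : 0 ≤ ∫ x, (f x - c * g x) ^ 2 ∂μ := integral_nonneg fun x => sq_nonneg _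
  have h2 : ∫ x, (f x - c * g x) ^ 2 ∂μ =
      ∫ x, f x ^ 2 ∂μ - 2 * c * ∫ x, f x * g x ∂μ + c ^ 2 * ∫ x, g x ^ 2 ∂μ := by
    have h3 : ∀ x, (f x - c * g x) ^ 2 = f x ^ 2 - 2 * c * (f x * g x) + c ^ 2 * g x ^ 2 :=
      fun x => by ring
    simp_rw [h3]
    have h4 : Integrable (fun x => f x ^ 2 - 2 * c * (f x * g x)) μ :=
      hf.integrable_sq.sub (hfg.const_mul _)
    rw [integral_add h4 (hg.integrable_sq.const_mul _),
      integral_sub hf.integrable_sq (hfg.const_mul _), integral_const_mul, integral_const_mul]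
  rw [h1, ← hc] at h2
  nlinarith

theorem MeasureTheory.MemLp.mul_prod_two {X : Type*} [MeasurableSpace X] {μ : Measure X} [SFinite μ]
    {f g : X → ℝ} (hf : MemLp f 2 μ) (hg : MemLp g 2 μ) :
    MemLp (fun p : X × X => f p.1 * g p.2) 2 (μ.prod μ) := by
  refine (memLp_two_iff_integrable_sq (hf.1.comp_fst.mul hg.1.comp_snd)).2 ?_
  simpa [mul_pow] using hf.integrable_sq.mul_prod hg.integrable_sq

/-! ### Partial sums of the spectral decomposition -/

theorem sum_Ico_sq_le_of_abs_le_rpow {ω : ℕ → ℝ} {α : ℝ} (hα : 1 / 2 < α)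
    (hω : ∀ i : ℕ, |ω i| ≤ ((i : ℝ) + 1) ^ (-α)) {k : ℕ} (hk : 1 ≤ k) (m : ℕ) :
    ∑ i ∈ Finset.Ico k m, ω i ^ 2 ≤ (k : ℝ) ^ (1 - 2 * α) / (2 * α - 1) := by
  have hk0 : (0 : ℝ) < k := by exact_mod_cast hk
  have hanti : AntitoneOn (fun x : ℝ => x ^ (-(2 * α))) (Set.Icc k m) := by
    intro x hx y _ hxy
    exact Real.rpow_le_rpow_of_nonpos (hk0.trans_le hx.1) hxy (by linarith)
  have h := hanti.sum_Ico_le_integral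
    (integrableOn_Ioi_rpow_of_lt (by linarith) hk0)
    fun t ht => Real.rpow_nonneg (hk0.trans ht).le _
  rw [integral_Ioi_rpow_of_lt (by linarith) hk0] at h
  refine (Finset.sum_le_sum fun i _ => ?_).trans (h.trans_eq ?_)
  · have h0 : (0 : ℝ) ≤ (i : ℝ) + 1 := by positivity
    calc ω i ^ 2 = |ω i| ^ 2 := (sq_abs _).symm
      _ ≤ (((i : ℝ) + 1) ^ (-α)) ^ 2 := by gcongr; exact hω i
      _ = ((i + 1 : ℕ) : ℝ) ^ (-(2 * α)) := by
        rw [← Real.rpow_natCast, ← Real.rpow_mul h0]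
        push_cast
        congr 1
        ring
  · rw [show -(2 * α) + 1 = -(2 * α - 1) by ring, neg_div_neg_eq]
    congr 2
    ring

namespace Graphon

theorem memLp_kernel (W : Graphon) :
    MemLp (fun p : unitInterval × unitInterval => W p.1 p.2) 2 volume :=
  MemLp.of_bound (W.measurable'.aestronglyMeasurable) 1 (Eventually.of_forall fun p => by
    rw [Real.norm_of_nonneg (W.nonneg' _ _)]; exact W.le_one' _ _)

theorem memLp_section (W : Graphon) (x : unitInterval) : MemLp (W x) 2 volume :=
  MemLp.of_bound (W.measurable'.of_uncurry_left.aestronglyMeasurable) 1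
    (Eventually.of_forall fun y => by
      rw [Real.norm_of_nonneg (W.nonneg' _ _)]; exact W.le_one' _ _)

end Graphon

namespace Graphon.IsTraceClassSpectralDecomposition

variable {W : Graphon} {ω : ℕ → ℝ} {φ : ℕ → unitInterval → ℝ}

theorem memLp_tensor (hW : W.IsTraceClassSpectralDecomposition ω φ) (s : Finset ℕ) :
    MemLp (fun p : unitInterval × unitInterval => ∑ i ∈ s, ω i * φ i p.1 * φ i p.2) 2 volume := by
  refine memLp_finsetSum s fun i _ => ?_
  simp_rw [mul_assoc]
  exact ((hW.memLp i).mul_prod_two (hW.memLp i)).const_mul (ω i)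

theorem memLp_kernel_sub (hW : W.IsTraceClassSpectralDecomposition ω φ) (k : ℕ) :
    MemLp (fun p : unitInterval × unitInterval =>
      W p.1 p.2 - ∑ i ∈ Finset.range k, ω i * φ i p.1 * φ i p.2) 2 volume :=
  (memLp_kernel W).sub (hW.memLp_tensor _)

theorem integral_tensor_sq (hW : W.IsTraceClassSpectralDecomposition ω φ) (s : Finset ℕ) :
    ∫ p : unitInterval × unitInterval, (∑ i ∈ s, ω i * φ i p.1 * φ i p.2) ^ 2 =
      ∑ i ∈ s, ω i ^ 2 := by
  have hint : ∀ i j, Integrable (fun p : unitInterval × unitInterval =>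
      (ω i * φ i p.1 * φ i p.2) * (ω j * φ j p.1 * φ j p.2)) volume := by
    intro i j
    have h : ∀ i, MemLp (fun p : unitInterval × unitInterval => ω i * φ i p.1 * φ i p.2) 2
        volume := fun i => by simpa using hW.memLp_tensor {i}
    exact (h i).integrable_mul (h j)
  have hval : ∀ i j, ∫ p : unitInterval × unitInterval,
      (ω i * φ i p.1 * φ i p.2) * (ω j * φ j p.1 * φ j p.2) = if i = j then ω i ^ 2 else 0 := by
    intro i j
    have h : ∀ p : unitInterval × unitInterval,
        (ω i * φ i p.1 * φ i p.2) * (ω j * φ j p.1 * φ j p.2) =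
        ω i * ω j * ((φ i p.1 * φ j p.1) * (φ i p.2 * φ j p.2)) := fun p => by ring
    simp_rw [h]
    rw [integral_const_mul, Measure.volume_eq_prod,
      integral_prod_mul (fun x => φ i x * φ j x) (fun x => φ i x * φ j x), hW.orthonormal]
    split_ifs with hij
    · subst hij; ring
    · ring
  simp_rw [sq (∑ i ∈ s, _), Finset.sum_mul_sum]
  rw [integral_finsetSum _ fun i _ => integrable_finsetSum _ fun j _ => hint i j]
  refine Finset.sum_congr rfl fun i hi => ?_
  rw [integral_finsetSum _ fun j _ => hint i j]
  simp [hval, hi]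

/-- The squared `L²` distance from `W` to its `k`-th partial sum is `∑_{i ≥ k} ω_i²`, which the
integral test bounds. -/
theorem integral_kernel_sub_sq_le (hW : W.IsTraceClassSpectralDecomposition ω φ) {α : ℝ}
    (hα : 1 / 2 < α) (hω : ∀ i : ℕ, |ω i| ≤ ((i : ℝ) + 1) ^ (-α)) {k : ℕ} (hk : 1 ≤ k) :
    ∫ p : unitInterval × unitInterval,
      (W p.1 p.2 - ∑ i ∈ Finset.range k, ω i * φ i p.1 * φ i p.2) ^ 2 ≤
        (k : ℝ) ^ (1 - 2 * α) / (2 * α - 1) := by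
  set c := (k : ℝ) ^ (1 - 2 * α) / (2 * α - 1) with hcdef
  have hc : 0 ≤ c := div_nonneg (by positivity) (by linarith)
  rw [← Real.sq_sqrt hc]
  refine (hW.memLp_kernel_sub k).integral_sq_le_of_eLpNorm_le (Real.sqrt_nonneg _) ?_
  have hlim := hW.tendsto_L2.add_const (ENNReal.ofReal √c)
  rw [zero_add] at hlim
  refine ge_of_tendsto hlim ?_
  filter_upwards [eventually_ge_atTop k] with m hm
  have hsplit : (fun p : unitInterval × unitInterval =>
      W p.1 p.2 - ∑ i ∈ Finset.range k, ω i * φ i p.1 * φ i p.2) =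
      (fun p => W p.1 p.2 - ∑ i ∈ Finset.range m, ω i * φ i p.1 * φ i p.2) +
      fun p => ∑ i ∈ Finset.Ico k m, ω i * φ i p.1 * φ i p.2 := by
    ext p
    simp only [Pi.add_apply]
    rw [Finset.sum_Ico_eq_sub _ hm]
    ring
  rw [hsplit]
  refine (eLpNorm_add_le (hW.memLp_kernel_sub m).1 (hW.memLp_tensor _).1 (by norm_num)).trans ?_
  gcongr
  rw [(hW.memLp_tensor _).eLpNorm_two_eq_ofReal_sqrt, hW.integral_tensor_sq]
  gcongr
  exact sum_Ico_sq_le_of_abs_le_rpow hα hω hk m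

theorem integral_sq_eq_one (hW : W.IsTraceClassSpectralDecomposition ω φ) (i : ℕ) :
    ∫ x, φ i x ^ 2 = 1 := by
  simpa [sq] using hW.orthonormal i i

/-- The eigenvalue equation for the kernel operator of `W`, almost everywhere. -/
theorem ae_integral_mul_eq (hW : W.IsTraceClassSpectralDecomposition ω φ) (j : ℕ) :
    ∀ᵐ x, ∫ y, W x y * φ j y = ω j * φ j x := by
  set T : unitInterval → ℝ := fun x => (∫ y, W x y * φ j y) - ω j * φ j x with hT
  have hTm : AEStronglyMeasurable T volume := by
    refine AEStronglyMeasurable.sub (f := fun x => ∫ y, W x y * φ j y) ?_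
      ((hW.memLp j).1.const_mul (ω j))
    exact AEStronglyMeasurable.integral_prod_right'
      (f := fun p : unitInterval × unitInterval => W p.1 p.2 * φ j p.2)
      ((memLp_kernel W).1.mul (hW.memLp j).1.comp_snd)
  -- Subtracting a partial sum that contains the `j`-th term accounts for the second summand of `T`.
  have hrepr : ∀ m, j < m → ∀ x,
      T x = ∫ y, (W x y - ∑ i ∈ Finset.range m, ω i * φ i x * φ i y) * φ j y := by
    intro m hm x
    have hi : ∀ i, Integrable (fun y => φ i y * φ j y) volume :=
      fun i => (hW.memLp i).integrable_mul (hW.memLp j)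
    simp_rw [sub_mul, Finset.sum_mul, mul_assoc]
    have hWφ : Integrable (fun y => W x y * φ j y) volume :=
      (memLp_section W x).integrable_mul (hW.memLp j)
    rw [integral_sub hWφ
      (integrable_finsetSum _ fun i _ => ((hi i).const_mul _).const_mul _),
      integral_finsetSum _ fun i _ => ((hi i).const_mul _).const_mul _]
    simp_rw [integral_const_mul, hW.orthonormal]
    simp [hT, hm]
  have hle : ∀ m, j < m → ∀ x, T x ^ 2 ≤
      ∫ y, (W x y - ∑ i ∈ Finset.range m, ω i * φ i x * φ i y) ^ 2 := by
    intro m hm x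
    rw [hrepr m hm x]
    refine sq_integral_mul_le_of_integral_sq_eq_one ?_ (hW.memLp j) (hW.integral_sq_eq_one j)
    exact (memLp_section W x).sub (memLp_finsetSum _ fun i _ => (hW.memLp i).const_mul _)
  have hR : ∀ m, Integrable (fun x => ∫ y,
      (W x y - ∑ i ∈ Finset.range m, ω i * φ i x * φ i y) ^ 2) volume := fun m =>
    (hW.memLp_kernel_sub m).integrable_sq.integral_prod_left
  have hTL : MemLp T 2 volume := by
    refine (memLp_two_iff_integrable_sq hTm).2 ((hR (j + 1)).mono' (hTm.pow 2) ?_)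
    refine Eventually.of_forall fun x => ?_
    rw [Real.norm_of_nonneg (sq_nonneg _)]
    exact hle _ (Nat.lt_succ_self j) x
  have hzero : eLpNorm T 2 volume = 0 := by
    refine le_antisymm (ge_of_tendsto hW.tendsto_L2 ?_) zero_le
    filter_upwards [eventually_gt_atTop j] with m hm
    rw [hTL.eLpNorm_two_eq_ofReal_sqrt, (hW.memLp_kernel_sub m).eLpNorm_two_eq_ofReal_sqrt]
    gcongr
    rw [Measure.volume_eq_prod, integral_prod _ (hW.memLp_kernel_sub m).integrable_sq]
    exact integral_mono hTL.integrable_sq (hR m) (hle m hm)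
  filter_upwards [(eLpNorm_eq_zero_iff hTm (by norm_num)).1 hzero] with x hx
  exact sub_eq_zero.1 (show (∫ y, W x y * φ j y) - ω j * φ j x = 0 from hx)

/-- `ω_j φ_j` is the image under a kernel with values in `[0, 1]` of a function of norm one. -/
theorem ae_abs_mul_le_one (hW : W.IsTraceClassSpectralDecomposition ω φ) (j : ℕ) :
    ∀ᵐ x, |ω j * φ j x| ≤ 1 := by
  filter_upwards [hW.ae_integral_mul_eq j] with x hx
  rw [← hx, ← sq_le_one_iff_abs_le_one]
  refine (sq_integral_mul_le_of_integral_sq_eq_one (memLp_section W x) (hW.memLp j)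
    (hW.integral_sq_eq_one j)).trans ?_
  calc ∫ y, W x y ^ 2 ≤ ∫ _ : unitInterval, (1 : ℝ) :=
        integral_mono (memLp_section W x).integrable_sq (integrable_const _)
          fun y => pow_le_one₀ (W.nonneg' _ _) (W.le_one' _ _)
    _ = 1 := by simp

/-! ### The diagonal -/

theorem memLp_diagonal_term (hW : W.IsTraceClassSpectralDecomposition ω φ) (j : ℕ) :
    MemLp (fun x => ω j * φ j x ^ 2) 2 volume := by
  refine (hW.memLp j).of_le (((hW.memLp j).1.pow 2).const_mul _) ?_
  filter_upwards [hW.ae_abs_mul_le_one j] with x hx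
  rw [sq, ← mul_assoc, norm_mul]
  exact mul_le_of_le_one_left (norm_nonneg _) hx

theorem memLp_diagonal_sum (hW : W.IsTraceClassSpectralDecomposition ω φ) (k : ℕ) :
    MemLp (fun x => ∑ i ∈ Finset.range k, ω i * φ i x ^ 2) 2 volume :=
  memLp_finsetSum _ fun i _ => hW.memLp_diagonal_term i

theorem ae_summable_diagonal (hW : W.IsTraceClassSpectralDecomposition ω φ) :
    ∀ᵐ x, Summable fun i => ω i * φ i x ^ 2 := by
  have hm : ∀ i, AEMeasurable (fun x => ‖ω i * φ i x ^ 2‖ₑ) volume :=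
    fun i => (hW.memLp_diagonal_term i).1.enorm
  have hint : ∀ i, ∫⁻ x, ‖ω i * φ i x ^ 2‖ₑ = ENNReal.ofReal |ω i| := by
    intro i
    rw [← ofReal_integral_norm_eq_lintegral_enorm ((hW.memLp i).integrable_sq.const_mul _)]
    simp_rw [norm_mul, Real.norm_of_nonneg (sq_nonneg (φ i _))]
    rw [integral_const_mul, hW.integral_sq_eq_one, mul_one, Real.norm_eq_abs]
  have hfin : ∫⁻ x, ∑' i, ‖ω i * φ i x ^ 2‖ₑ ≠ ⊤ := by
    rw [lintegral_tsum hm]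
    simp_rw [hint]
    exact hW.summable_abs.tsum_ofReal_ne_top
  filter_upwards [ae_lt_top' (AEMeasurable.tsum hm) hfin] with x hx
  exact .of_nnnorm (ENNReal.tsum_coe_ne_top_iff_summable.1 hx.ne)

/-- Past an index where the tail has norm at most one, the partial sums of the diagonal change by at
most two tails; before it there are finitely many of them. -/
theorem exists_integral_diagonal_sum_sq_le (hW : W.IsTraceClassSpectralDecomposition ω φ)
    (hdiag : L2DiagonalTail ω φ) :
    ∃ C : ℝ, ∀ k, ∫ x, (∑ i ∈ Finset.range k, ω i * φ i x ^ 2) ^ 2 ≤ C := by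
  set D : ℕ → unitInterval → ℝ := fun k x => ∑ i ∈ Finset.range k, ω i * φ i x ^ 2 with hD
  set T : ℕ → unitInterval → ℝ := fun k x => ∑' i, ω (i + k) * φ (i + k) x ^ 2 with hT
  have hDL : ∀ k, MemLp (D k) 2 volume := hW.memLp_diagonal_sum
  have hTm : ∀ k, AEStronglyMeasurable (T k) volume := fun k =>
    (AEMeasurable.tsum fun i =>
      (hW.memLp_diagonal_term (i + k)).1.aemeasurable).aestronglyMeasurable
  have hdiag' : Tendsto (fun k => eLpNorm (T k) 2 volume) atTop (𝓝 0) := hdiag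
  obtain ⟨K, hK⟩ := eventually_atTop.1 (hdiag'.eventually_le_const zero_lt_one)
  have hDT : ∀ k, D k =ᵐ[volume] (D K + T K) - T k := by
    intro k
    filter_upwards [hW.ae_summable_diagonal] with x hx
    have h1 := hx.sum_add_tsum_nat_add k
    have h2 := hx.sum_add_tsum_nat_add K
    simp only [hD, hT, Pi.sub_apply, Pi.add_apply]
    linarith
  set B : ENNReal := ∑ j ∈ Finset.range (K + 1), eLpNorm (D j) 2 volume + (1 + 1) with hB
  have hBtop : B ≠ ⊤ := by
    simp only [hB, ne_eq, ENNReal.add_eq_top, ENNReal.sum_eq_top, ENNReal.one_ne_top, or_self,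
      or_false, not_exists, not_and]
    exact fun j _ => (hDL j).2.ne
  have hbound : ∀ k, eLpNorm (D k) 2 volume ≤ B := by
    intro k
    rcases le_or_gt k K with hk | hk
    · exact (Finset.single_le_sum (f := fun j => eLpNorm (D j) 2 volume) (fun _ _ => zero_le)
        (Finset.mem_range.2 (Nat.lt_succ_of_le hk))).trans le_self_add
    · rw [eLpNorm_congr_ae (hDT k)]
      calc eLpNorm ((D K + T K) - T k) 2 volume
          ≤ (eLpNorm (D K) 2 volume + eLpNorm (T K) 2 volume) + eLpNorm (T k) 2 volume :=
            (eLpNorm_sub_le ((hDL K).1.add (hTm K)) (hTm k) (by norm_num)).trans <| by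
              gcongr
              exact eLpNorm_add_le (hDL K).1 (hTm K) (by norm_num)
        _ ≤ (eLpNorm (D K) 2 volume + 1) + 1 := by
            gcongr
            · exact hK K le_rfl
            · exact hK k hk.le
        _ ≤ B := by
            rw [add_assoc, hB]
            gcongr
            exact Finset.single_le_sum (f := fun j => eLpNorm (D j) 2 volume)
              (fun _ _ => zero_le) (Finset.self_mem_range_succ K)
  refine ⟨B.toReal ^ 2, fun k => (hDL k).integral_sq_le_of_eLpNorm_le ENNReal.toReal_nonneg ?_⟩
  rw [ENNReal.ofReal_toReal hBtop]
  exact hbound k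

end Graphon.IsTraceClassSpectralDecomposition

/-! ### The sampled matrix -/

theorem ProbabilityTheory.HasLaw.integrable_comp_iff {Ω X : Type*} [MeasurableSpace Ω]
    [MeasurableSpace X] {P : Measure Ω} {μ : Measure X} {Y : Ω → X} (hY : HasLaw Y μ P)
    {f : X → ℝ} (hf : AEStronglyMeasurable f μ) :
    Integrable (fun a => f (Y a)) P ↔ Integrable f μ := by
  have h := hY.map_eq
  subst h
  exact (integrable_map_measure hf hY.aemeasurable).symm

namespace Graphon

theorem integrable_eigenvaluesByAbs_sq (W : Graphon) {n : ℕ} {Ω : Type*} [MeasurableSpace Ω]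
    {P : Measure Ω} [IsFiniteMeasure P] {ξ : Fin n → Ω → unitInterval}
    (hξ : ∀ u, AEMeasurable (ξ u) P) (i : Fin n) :
    Integrable (fun a =>
      eigenvaluesByAbs (W.sampleMatrix_isHermitian fun u => ξ u a) i ^ 2) P := by
  have hmat : AEMeasurable (fun a (u v : Fin n) => W.sampleMatrix (fun u => ξ u a) u v) P := by
    refine aemeasurable_pi_lambda _ fun u => aemeasurable_pi_lambda _ fun v => ?_
    simp only [sampleMatrix, Matrix.of_apply]
    split_ifs
    · exact aemeasurable_const
    · exact W.measurable'.comp_aemeasurable ((hξ u).prodMk (hξ v))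
  have hdist : ∀ k, AEMeasurable (fun a => rankDistSq k (W.sampleMatrix fun u => ξ u a)) P :=
    fun k => (measurable_rankDistSq k).comp_aemeasurable hmat
  refine Integrable.of_bound (C := ∑ _u : Fin n, ∑ _v : Fin n, (1 : ℝ)) ?_
    (Eventually.of_forall fun a => ?_)
  · simp_rw [eigenvaluesByAbs_sq_eq]
    exact ((hdist _).sub (hdist _)).aestronglyMeasurable
  · rw [Real.norm_of_nonneg (sq_nonneg _)]
    refine (eigenvaluesByAbs_sq_le_sum_sq _ i).trans ?_
    gcongr with u _ v
    simp only [sampleMatrix, Matrix.of_apply]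
    split_ifs
    · simp
    · exact pow_le_one₀ (W.nonneg' _ _) (W.le_one' _ _)

/-- A pair of independent uniform points is uniform on the square, so that the mean squared error
of the `k`-th partial sum is its squared `L²` distance from `W`. -/
theorem IsTraceClassSpectralDecomposition.integral_offDiag {W : Graphon} {ω : ℕ → ℝ}
    {φ : ℕ → unitInterval → ℝ} (hW : W.IsTraceClassSpectralDecomposition ω φ) (k : ℕ)
    {Ω : Type*} [MeasurableSpace Ω] {P : Measure Ω} [IsProbabilityMeasure P]
    {X Y : Ω → unitInterval} (hX : HasLaw X volume P) (hY : HasLaw Y volume P)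
    (hXY : IndepFun X Y P) :
    Integrable (fun a =>
      (W (X a) (Y a) - ∑ i ∈ Finset.range k, ω i * φ i (X a) * φ i (Y a)) ^ 2) P ∧
    ∫ a, (W (X a) (Y a) - ∑ i ∈ Finset.range k, ω i * φ i (X a) * φ i (Y a)) ^ 2 ∂P =
      ∫ p : unitInterval × unitInterval,
        (W p.1 p.2 - ∑ i ∈ Finset.range k, ω i * φ i p.1 * φ i p.2) ^ 2 := by
  have hlaw : HasLaw (fun a => (X a, Y a)) (volume.prod volume) P := hXY.hasLaw_prod hX hY
  have hint := (hW.memLp_kernel_sub k).integrable_sq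
  rw [Measure.volume_eq_prod] at hint ⊢
  exact ⟨(hlaw.integrable_comp_iff hint.1).2 hint, hlaw.integral_comp hint.1⟩

theorem IsTraceClassSpectralDecomposition.integral_diag {W : Graphon} {ω : ℕ → ℝ}
    {φ : ℕ → unitInterval → ℝ} (hW : W.IsTraceClassSpectralDecomposition ω φ) (k : ℕ)
    {Ω : Type*} [MeasurableSpace Ω] {P : Measure Ω} {X : Ω → unitInterval}
    (hX : HasLaw X volume P) :
    Integrable (fun a => (∑ i ∈ Finset.range k, ω i * φ i (X a) ^ 2) ^ 2) P ∧
    ∫ a, (∑ i ∈ Finset.range k, ω i * φ i (X a) ^ 2) ^ 2 ∂P =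
      ∫ x, (∑ i ∈ Finset.range k, ω i * φ i x ^ 2) ^ 2 := by
  have hint := (hW.memLp_diagonal_sum k).integrable_sq
  exact ⟨(hX.integrable_comp_iff hint.1).2 hint, hX.integral_comp hint.1⟩

end Graphon

theorem mainTheorem1 (W : Graphon) (ω : ℕ → ℝ) (φ : ℕ → unitInterval → ℝ) (α : ℝ)
    (hα : 1 / 2 < α)
    (hW : W.IsTraceClassSpectralDecomposition ω φ)
    (hω : ∀ i : ℕ, |ω i| ≤ ((i : ℝ) + 1) ^ (-α))
    (hdiag : L2DiagonalTail ω φ) :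
    ∃ C : ℝ, ∀ (n k : ℕ), 1 ≤ n → 1 ≤ k →
      ∀ {Ω : Type u} [MeasurableSpace Ω] (P : Measure Ω) [IsProbabilityMeasure P]
        (ξ : Fin n → Ω → unitInterval),
        (∀ u, HasLaw (ξ u) (volume : Measure unitInterval) P) → iIndepFun ξ P →
        (∀ i : Fin n, Integrable (fun a =>
          eigenvaluesByAbs (W.sampleMatrix_isHermitian fun u => ξ u a) i ^ 2) P) ∧
        1 / (n : ℝ) ^ 2 * ∑ i ∈ Finset.univ.filter (fun j : Fin n => k ≤ (j : ℕ)),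
            ∫ a, eigenvaluesByAbs (W.sampleMatrix_isHermitian fun u => ξ u a) i ^ 2 ∂P
          ≤ 2 * (k : ℝ) ^ (1 - 2 * α) / (2 * α - 1) + C / n := by
  obtain ⟨C, hC⟩ := hW.exists_integral_diagonal_sum_sq_le hdiag
  refine ⟨C, fun n k hn hk Ω _ P _ ξ hξ hindep => ?_⟩
  have hint := W.integrable_eigenvaluesByAbs_sq fun u => (hξ u).aemeasurable
  refine ⟨hint, ?_⟩
  set c := (k : ℝ) ^ (1 - 2 * α) / (2 * α - 1) with hcdef
  have hc : 0 ≤ c := div_nonneg (by positivity) (by linarith)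
  have hn0 : (0 : ℝ) < n := by exact_mod_cast hn
  let F : Fin n → Fin n → Ω → ℝ := fun u v a => (W.sampleMatrix (fun u => ξ u a) u v -
    ∑ l ∈ Finset.range k, ω l * φ l (ξ u a) * φ l (ξ v a)) ^ 2
  have hF : ∀ u v, Integrable (F u v) P ∧ ∫ a, F u v a ∂P ≤ c + if u = v then C else 0 := by
    intro u v
    by_cases huv : u = v
    · subst huv
      have hFu : F u u = fun a => (∑ i ∈ Finset.range k, ω i * φ i (ξ u a) ^ 2) ^ 2 := by
        ext a
        simp [F, Graphon.sampleMatrix, mul_assoc, sq]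
      obtain ⟨h1, h2⟩ := hW.integral_diag k (hξ u)
      rw [hFu, if_pos rfl, h2]
      exact ⟨h1, (hC k).trans (le_add_of_nonneg_left hc)⟩
    · have hFuv : F u v = fun a => (W (ξ u a) (ξ v a) -
          ∑ i ∈ Finset.range k, ω i * φ i (ξ u a) * φ i (ξ v a)) ^ 2 := by
        ext a
        simp [F, Graphon.sampleMatrix, huv]
      obtain ⟨h1, h2⟩ := hW.integral_offDiag k (hξ u) (hξ v) (hindep.indepFun huv)
      rw [hFuv, if_neg huv, h2, add_zero]
      exact ⟨h1, hW.integral_kernel_sub_sq_le hα hω hk⟩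
  have hsum : ∑ i ∈ Finset.univ.filter (fun j : Fin n => k ≤ (j : ℕ)),
      ∫ a, eigenvaluesByAbs (W.sampleMatrix_isHermitian fun u => ξ u a) i ^ 2 ∂P ≤
      (n : ℝ) ^ 2 * c + n * C := by
    rw [← integral_finsetSum _ fun i _ => hint i]
    calc _ ≤ ∫ a, ∑ u, ∑ v, F u v a ∂P := by
          refine integral_mono (integrable_finsetSum _ fun i _ => hint i)
            (integrable_finsetSum _ fun u _ => integrable_finsetSum _ fun v _ => (hF u v).1)
            fun a => ?_
          -- The partial sum of the kernel at the sample points has rank at most `k`.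
          exact sum_tail_eigenvaluesByAbs_sq_le k _ (fun l u => ω l * φ l (ξ u a))
            fun l u => φ l (ξ u a)
      _ = ∑ u, ∑ v, ∫ a, F u v a ∂P := by
          rw [integral_finsetSum _ fun u _ => integrable_finsetSum _ fun v _ => (hF u v).1]
          exact Finset.sum_congr rfl fun u _ => integral_finsetSum _ fun v _ => (hF u v).1
      _ ≤ ∑ u : Fin n, ∑ v : Fin n, (c + if u = v then C else 0) :=
          Finset.sum_le_sum fun u _ => Finset.sum_le_sum fun v _ => (hF u v).2
      _ = (n : ℝ) ^ 2 * c + n * C := by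
          simp [Finset.sum_add_distrib]
          ring
  calc _ ≤ 1 / (n : ℝ) ^ 2 * ((n : ℝ) ^ 2 * c + n * C) := by gcongr
    _ = c + C / n := by field_simp
    _ ≤ 2 * c + C / n := by linarith
    _ = _ := by rw [hcdef, mul_div_assoc]
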